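/- Let $(X,H,W,Y(0),Y(1))$ be random variables on a probability space, with covariates $X\in\mathbb{R}^d$, site $H\in\{1,\dots,K\}$, treatment $W\in\{0,1\}$ and bounded real potential outcomes $Y(0),Y(1)$, and let $Y=WY(1)+(1-W)Y(0)$ be the observed outcome. Let $e(x)=\mathbb{P}(W=1\mid X=x)$, $\mu_w(x)=\mathbb{E}[Y\mid X=x,W=w]$ for $w\in\{0,1\}$, $\tau=\mathbb{E}[Y(1)-Y(0)]$ and $\tau(x)=\mathbb{E}[Y(1)-Y(0)\mid X=x]$. Assume - (unconfoundedness) $(Y(0),Y(1))\perp\!\!\!\perp W\mid X$; - (ignorability on sites) $(Y(0),Y(1))\perp\!\!\!\perp H\mid X$; - (global overlap) $\mathbb{E}\big[(e(X)(1-e(X)))^{-1}\big]<\infty$. Let $(H_i,X_i,W_i,Y_i)_{i\ge 1}$ be i.i.d. with the law of $(H,X,W,Y)$, and for $n\ge1$ let $$\hat\tau^*_{\mathrm{IPW}}=\frac1n\sum_{i=1}^n\Big(\frac{W_iY_i}{e(X_i)}-\frac{(1-W_i)Y_i}{1-e(X_i)}\Big),$$ $$\hat\tau^*_{\mathrm{AIPW}}=\frac1n\sum_{i=1}^n\Big(\mu_1(X_i)-\mu_0(X_i)+\frac{W_i(Y_i-\mu_1(X_i))}{e(X_i)}-\frac{(1-W_i)(Y_i-\mu_0(X_i))}{1-e(X_i)}\Big).$$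 Then the quantities $$V_{\mathrm{IPW}}=\mathbb{E}\Big[\frac{Y(1)^2}{e(X)}\Big]+\mathbb{E}\Big[\frac{Y(0)^2}{1-e(X)}\Big]-\tau^2,$$ $$V_{\mathrm{AIPW}}=\mathbb{V}[\tau(X)]+\mathbb{E}\Big[\frac{(Y(1)-\mu_1(X))^2}{e(X)}\Big]+\mathbb{E}\Big[\frac{(Y(0)-\mu_0(X))^2}{1-e(X)}\Big]$$ are well defined and finite (every expectation and variance in them is finite), and for each of the two estimators $\hat\tau\in\{\hat\tau^*_{\mathrm{IPW}},\hat\tau^*_{\mathrm{AIPW}}\}$, with the corresponding $V\in\{V_{\mathrm{IPW}},V_{\mathrm{AIPW}}\}$: $\hat\tau$ is square integrable, $\mathbb{E}[\hat\tau]=\tau$ and $\mathbb{V}[\hat\tau]=V/n$ for every $n\ge1$, and $\sqrt n(\hat\tau-\tau)\to\mathcal N(0,V)$ in distribution as $n\to\infty$. -/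

import Mathlib

open MeasureTheory ProbabilityTheory Filter
open scoped ENNReal

namespace FedCausal

/-- The space `ℝ^d` of patient covariates. -/
abbrev Covariates (d : ℕ) : Type := EuclideanSpace ℝ (Fin d)

/-- An observed tuple `(H, X, W, Y)`: site, covariates, treatment, observed outcome. -/
abbrev Observation (d K : ℕ) : Type := Fin K × Covariates d × Fin 2 × ℝ

/-- The treatment indicator as a real number: `0` or `1`. -/
def treat (w : Fin 2) : ℝ := (w.val : ℝ)

section Population

variable {Ω : Type*} [MeasurableSpace Ω]

/-- The observed outcome `Y = W Y(1) + (1 - W) Y(0)` (SUTVA); `Y w` is the potential outcome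
under treatment `w`. -/
def observedOutcome (W : Ω → Fin 2) (Y : Fin 2 → Ω → ℝ) (ω : Ω) : ℝ :=
  treat (W ω) * Y 1 ω + (1 - treat (W ω)) * Y 0 ω

/-- The observed tuple `(H, X, W, Y)` of a member of the population. -/
def observedTuple {d K : ℕ} (X : Ω → Covariates d) (H : Ω → Fin K) (W : Ω → Fin 2)
    (Y : Fin 2 → Ω → ℝ) (ω : Ω) : Observation d K :=
  (H ω, X ω, W ω, observedOutcome W Y ω)

/-- `U` and `V` are conditionally independent given (the σ-algebra generated by) `X`:
`P(U ∈ s, V ∈ t | X) = P(U ∈ s | X) P(V ∈ t | X)` almost surely, for all measurable `s`, `t`.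
Mathlib's `CondIndepFun` is the same notion on standard Borel spaces, see
`condIndepGiven_iff_condIndepFun`; here the probability space is arbitrary. -/
def CondIndepGiven {α β γ : Type*} [MeasurableSpace α] [MeasurableSpace β] [MeasurableSpace γ]
    (P : Measure Ω) (U : Ω → α) (V : Ω → β) (X : Ω → γ) : Prop :=
  ∀ (s : Set α) (t : Set β), MeasurableSet s → MeasurableSet t →
    P⟦U ⁻¹' s ∩ V ⁻¹' t | MeasurableSpace.comap X inferInstance⟧ =ᵐ[P]
      fun ω ↦ (P⟦U ⁻¹' s | MeasurableSpace.comap X inferInstance⟧) ω *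
        (P⟦V ⁻¹' t | MeasurableSpace.comap X inferInstance⟧) ω

theorem condIndepGiven_iff_condIndepFun [StandardBorelSpace Ω] {α β γ : Type*}
    [MeasurableSpace α] [MeasurableSpace β] [MeasurableSpace γ]
    (P : Measure Ω) [IsFiniteMeasure P] {U : Ω → α} {V : Ω → β} {X : Ω → γ}
    (hU : Measurable U) (hV : Measurable V) (hX : Measurable X) :
    CondIndepGiven P U V X ↔
      CondIndepFun (MeasurableSpace.comap X inferInstance) hX.comap_le U V P :=
  (condIndepFun_iff_condExp_inter_preimage_eq_mul hU hV).symm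

/-- `e` is a version of the propensity score `e(x) = P(W = 1 | X = x)`. -/
structure IsPropensityScore {d : ℕ} (P : Measure Ω) (X : Ω → Covariates d) (W : Ω → Fin 2)
    (e : Covariates d → ℝ) : Prop where
  measurable : Measurable e
  ae_eq : ∀ᵐ ω ∂P, e (X ω) = (P⟦W ⁻¹' {1} | MeasurableSpace.comap X inferInstance⟧) ω

/-- `m` is a version of the outcome regression `m(x) = E[Y | X = x, W = w]`, for the observed
outcome `Yobs` and the fixed treatment arm `w`: on the event `W = w`, the conditional expectation
of `Yobs` given `(X, W)` is `m(X)`. -/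
structure IsOutcomeRegression {d : ℕ} (P : Measure Ω) (X : Ω → Covariates d) (W : Ω → Fin 2)
    (Yobs : Ω → ℝ) (w : Fin 2) (m : Covariates d → ℝ) : Prop where
  measurable : Measurable m
  ae_eq : ∀ᵐ ω ∂P, W ω = w →
    m (X ω) = (P[Yobs | MeasurableSpace.comap (fun ω' ↦ (X ω', W ω')) inferInstance]) ω

/-- Global overlap `E[(e(X)(1 - e(X)))⁻¹] < ∞`, as an integral with values in `[0, ∞]`, where
`0⁻¹ = ∞`. -/
def GlobalOverlap {d : ℕ} (P : Measure Ω) (X : Ω → Covariates d) (e : Covariates d → ℝ) : Prop :=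
  ∫⁻ ω, (ENNReal.ofReal (e (X ω) * (1 - e (X ω))))⁻¹ ∂P < ∞

/-- The average treatment effect `τ = E[Y(1) - Y(0)]`. -/
noncomputable def ate (P : Measure Ω) (Y : Fin 2 → Ω → ℝ) : ℝ :=
  ∫ ω, (Y 1 ω - Y 0 ω) ∂P

/-- The conditional average treatment effect `τ(X) = E[Y(1) - Y(0) | X]`, a random variable. -/
noncomputable def cate {d : ℕ} (P : Measure Ω) (X : Ω → Covariates d) (Y : Fin 2 → Ω → ℝ) :
    Ω → ℝ :=
  P[fun ω ↦ Y 1 ω - Y 0 ω | MeasurableSpace.comap X inferInstance]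

/-- `E[Y(1)² / e(X)] + E[Y(0)² / (1 - e(X))] - τ²`. -/
noncomputable def ipwVariance {d : ℕ} (P : Measure Ω) (X : Ω → Covariates d) (Y : Fin 2 → Ω → ℝ)
    (e : Covariates d → ℝ) : ℝ :=
  (∫ ω, Y 1 ω ^ 2 / e (X ω) ∂P) + (∫ ω, Y 0 ω ^ 2 / (1 - e (X ω)) ∂P) - ate P Y ^ 2

/-- `Var[τ(X)] + E[(Y(1) - μ₁(X))² / e(X)] + E[(Y(0) - μ₀(X))² / (1 - e(X))]`. -/
noncomputable def aipwVariance {d : ℕ} (P : Measure Ω) (X : Ω → Covariates d) (Y : Fin 2 → Ω → ℝ)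
    (e : Covariates d → ℝ) (μ : Fin 2 → Covariates d → ℝ) : ℝ :=
  Var[cate P X Y; P] + (∫ ω, (Y 1 ω - μ 1 (X ω)) ^ 2 / e (X ω) ∂P) +
    ∫ ω, (Y 0 ω - μ 0 (X ω)) ^ 2 / (1 - e (X ω)) ∂P

end Population

section Estimators

/-- `W Y / e(X) - (1 - W) Y / (1 - e(X))`. -/
noncomputable def ipwScore {d K : ℕ} (e : Covariates d → ℝ) : Observation d K → ℝ
  | (_, x, w, y) => treat w * y / e x - (1 - treat w) * y / (1 - e x)

/-- `μ₁(X) - μ₀(X) + W (Y - μ₁(X)) / e(X) - (1 - W) (Y - μ₀(X)) / (1 - e(X))`. -/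
noncomputable def aipwScore {d K : ℕ} (e : Covariates d → ℝ) (μ : Fin 2 → Covariates d → ℝ) :
    Observation d K → ℝ
  | (_, x, w, y) => μ 1 x - μ 0 x + treat w * (y - μ 1 x) / e x
      - (1 - treat w) * (y - μ 0 x) / (1 - e x)

/-- The oracle centralized IPW estimator computed from the first `n` observations. -/
noncomputable def ipwEstimator {d K : ℕ} {Ω' : Type*} (e : Covariates d → ℝ)
    (O : ℕ → Ω' → Observation d K) (n : ℕ) (ω : Ω') : ℝ :=
  (1 / (n : ℝ)) * ∑ i ∈ Finset.range n, ipwScore e (O i ω)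

/-- The oracle centralized AIPW estimator computed from the first `n` observations. -/
noncomputable def aipwEstimator {d K : ℕ} {Ω' : Type*} (e : Covariates d → ℝ)
    (μ : Fin 2 → Covariates d → ℝ) (O : ℕ → Ω' → Observation d K) (n : ℕ) (ω : Ω') : ℝ :=
  (1 / (n : ℝ)) * ∑ i ∈ Finset.range n, aipwScore e μ (O i ω)

end Estimators

end FedCausal

open FedCausal

/-! Each estimator is the mean of `n` independent copies of one score, so linearity, independence
and the central limit theorem reduce everything to the mean and variance of that score
(`sampleMean_moments`, `tendstoInDistribution_sampleMean`).

The weight `1{W = w} / P(W = w | X)` has conditional mean one given `X`, and by unconfoundedness it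
is conditionally independent of the potential outcomes. Inserting it therefore preserves
expectations of functions of `(X, Y 0, Y 1)` (`isBalancing_armWeight`); overlap makes the inverse
probabilities integrable. This one principle gives the first moments, the second moments (the
squared weight is the weight divided by the probability), and the identification of `μ w (X)` with
`E[Y w | X]` (`regression_ae_eq_condExp`).

Up to a constant, both scores are `D(X)` plus the weighted residual of arm 1 minus that of arm 0.
The two weights are never both nonzero and `D(X)` is orthogonal to the residuals, so the second
moment splits into three terms (`augmentedScore_moments`). IPW is the case `D = 0`, `m = 0`; AIPW
takes `m = μ` and `D = μ₁ - μ₀ - τ`. -/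

namespace FedCausal

/-! ### Inverse probability weighting as a change of measure. -/

section Weighting

variable {Ω α γ : Type*} [MeasurableSpace Ω] [MeasurableSpace α] [MeasurableSpace γ]
  {P : Measure Ω} [IsProbabilityMeasure P] {X : Ω → γ} {U : Ω → α} {A : Set Ω} {p : γ → ℝ}

/-- Inverse probability weighting on rectangles. -/
theorem setIntegral_indicator_inv_eq (hX : Measurable X) (hU : Measurable U)
    (hA : MeasurableSet A) (hp : Measurable p)
    (hpA : ∀ᵐ ω ∂P, p (X ω) = (P⟦A | MeasurableSpace.comap X inferInstance⟧) ω)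
    (hpos : ∀ᵐ ω ∂P, 0 < p (X ω)) (hint : Integrable (fun ω ↦ (p (X ω))⁻¹) P)
    {s : Set γ} {t : Set α} (hs : MeasurableSet s) (ht : MeasurableSet t)
    (hCI : P⟦U ⁻¹' t ∩ A | MeasurableSpace.comap X inferInstance⟧ =ᵐ[P]
      fun ω ↦ (P⟦U ⁻¹' t | MeasurableSpace.comap X inferInstance⟧) ω *
        (P⟦A | MeasurableSpace.comap X inferInstance⟧) ω) :
    ∫ ω in X ⁻¹' s ∩ U ⁻¹' t, A.indicator (fun ω ↦ (p (X ω))⁻¹) ω ∂P =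
      P.real (X ⁻¹' s ∩ U ⁻¹' t) := by
  have hm : MeasurableSpace.comap X inferInstance ≤ ‹MeasurableSpace Ω› := hX.comap_le
  have hs' : MeasurableSet[MeasurableSpace.comap X inferInstance] (X ⁻¹' s) := ⟨s, hs, rfl⟩
  set f : Ω → ℝ := (X ⁻¹' s).indicator (fun ω ↦ (p (X ω))⁻¹) with hf
  set g : Ω → ℝ := (U ⁻¹' t ∩ A).indicator (fun _ ↦ (1 : ℝ)) with hg
  have hfm : StronglyMeasurable[MeasurableSpace.comap X inferInstance] f :=
    ((hp.inv.comp (comap_measurable X)).indicator hs').stronglyMeasurable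
  have hfg : f * g =
      (X ⁻¹' s ∩ U ⁻¹' t).indicator (A.indicator fun ω ↦ (p (X ω))⁻¹) := by
    ext ω
    by_cases h1 : X ω ∈ s <;> by_cases h2 : U ω ∈ t <;> by_cases h3 : ω ∈ A <;>
      simp [hf, hg, h1, h2, h3]
  have hgi : Integrable g P := (integrable_const 1).indicator ((hU ht).inter hA)
  have hfgi : Integrable (f * g) P := by
    rw [hfg]
    exact (hint.indicator hA).indicator ((hX hs).inter (hU ht))
  have h1 : ∫ ω, (f * g) ω ∂P =
      ∫ ω in X ⁻¹' s, (P⟦U ⁻¹' t | MeasurableSpace.comap X inferInstance⟧) ω ∂P := by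
    rw [← integral_condExp hm, ← integral_indicator (hX hs)]
    refine integral_congr_ae ?_
    -- Pulling out the `X`-measurable factor `f` and factorizing by conditional independence leaves
    -- `P(A | X)`, which cancels against the inverse of `p (X)`.
    filter_upwards [condExp_mul_of_stronglyMeasurable_left hfm hfgi hgi, hCI, hpA, hpos]
      with ω h1 h2 h3 h4
    rw [h1, Pi.mul_apply, h2, ← h3]
    by_cases h5 : X ω ∈ s
    · simp [hf, h5]
      field_simp
    · simp [hf, h5]
  rw [← integral_indicator ((hX hs).inter (hU ht)), ← hfg, h1,
    setIntegral_condExp hm ((integrable_const 1).indicator (hU ht)) hs',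
    integral_indicator (hU ht), Measure.restrict_restrict (hU ht), Set.inter_comm]
  simp

/-- Inverse probability weighting: reweighting the event `A` by its inverse conditional probability
given `X` restores the joint law of `(X, U)` when `U` and `A` are conditionally independent
given `X`. -/
theorem map_withDensity_indicator_inv (hX : Measurable X) (hU : Measurable U)
    (hA : MeasurableSet A) (hp : Measurable p)
    (hpA : ∀ᵐ ω ∂P, p (X ω) = (P⟦A | MeasurableSpace.comap X inferInstance⟧) ω)
    (hpos : ∀ᵐ ω ∂P, 0 < p (X ω)) (hint : Integrable (fun ω ↦ (p (X ω))⁻¹) P)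
    (hCI : ∀ t, MeasurableSet t → P⟦U ⁻¹' t ∩ A | MeasurableSpace.comap X inferInstance⟧ =ᵐ[P]
      fun ω ↦ (P⟦U ⁻¹' t | MeasurableSpace.comap X inferInstance⟧) ω *
        (P⟦A | MeasurableSpace.comap X inferInstance⟧) ω) :
    (P.withDensity fun ω ↦ ENNReal.ofReal (A.indicator (fun ω ↦ (p (X ω))⁻¹) ω)).map
      (fun ω ↦ (X ω, U ω)) = P.map (fun ω ↦ (X ω, U ω)) := by
  have hi : Integrable (A.indicator fun ω ↦ (p (X ω))⁻¹) P := hint.indicator hA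
  -- Finiteness is what lets rectangles determine the measure below.
  have := isFiniteMeasure_withDensity_ofReal hi.2
  refine Measure.ext_prod fun {s t} hs ht ↦ ?_
  have hst : MeasurableSet (X ⁻¹' s ∩ U ⁻¹' t) := (hX hs).inter (hU ht)
  rw [Measure.map_apply (hX.prodMk hU) (hs.prod ht), Measure.map_apply (hX.prodMk hU) (hs.prod ht),
    Set.mk_preimage_prod, withDensity_apply _ hst, ← ofReal_integral_eq_lintegral_ofReal
      hi.integrableOn, setIntegral_indicator_inv_eq hX hU hA hp hpA hpos hint hs ht (hCI t ht),
    ofReal_measureReal]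
  filter_upwards [ae_restrict_of_ae hpos] with ω hω
  by_cases h : ω ∈ A <;> simp [h, hω.le]

/-- The weight `ν` balances `(X, U)`: weighted expectations of functions of `(X, U)` are the
unweighted ones. -/
def IsBalancing (P : Measure Ω) (X : Ω → γ) (U : Ω → α) (ν : Ω → ℝ) : Prop :=
  ∀ F : γ × α → ℝ, Measurable F →
    (Integrable (fun ω ↦ ν ω * F (X ω, U ω)) P ↔ Integrable (fun ω ↦ F (X ω, U ω)) P) ∧
      ∫ ω, ν ω * F (X ω, U ω) ∂P = ∫ ω, F (X ω, U ω) ∂P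

/-- Equality of the two joint laws, read through the change of variables formula. The integrability
equivalence is kept apart because equal Bochner integrals carry no integrability; it later yields
square integrability of the scores. -/
theorem isBalancing_indicator_inv (hX : Measurable X) (hU : Measurable U)
    (hA : MeasurableSet A) (hp : Measurable p)
    (hpA : ∀ᵐ ω ∂P, p (X ω) = (P⟦A | MeasurableSpace.comap X inferInstance⟧) ω)
    (hpos : ∀ᵐ ω ∂P, 0 < p (X ω)) (hint : Integrable (fun ω ↦ (p (X ω))⁻¹) P)
    (hCI : ∀ t, MeasurableSet t → P⟦U ⁻¹' t ∩ A | MeasurableSpace.comap X inferInstance⟧ =ᵐ[P]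
      fun ω ↦ (P⟦U ⁻¹' t | MeasurableSpace.comap X inferInstance⟧) ω *
        (P⟦A | MeasurableSpace.comap X inferInstance⟧) ω) :
    IsBalancing P X U (A.indicator fun ω ↦ (p (X ω))⁻¹) := by
  intro F hF
  have hXU : Measurable fun ω ↦ (X ω, U ω) := hX.prodMk hU
  have hν : Measurable fun ω ↦ ENNReal.ofReal (A.indicator (fun ω ↦ (p (X ω))⁻¹) ω) :=
    ((hp.comp hX).inv.indicator hA).ennreal_ofReal
  have hfin : ∀ᵐ ω ∂P, ENNReal.ofReal (A.indicator (fun ω ↦ (p (X ω))⁻¹) ω) < ∞ := by simp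
  have hae : (fun ω ↦ (ENNReal.ofReal (A.indicator (fun ω ↦ (p (X ω))⁻¹) ω)).toReal •
      F (X ω, U ω)) =ᵐ[P] fun ω ↦ A.indicator (fun ω ↦ (p (X ω))⁻¹) ω * F (X ω, U ω) := by
    filter_upwards [hpos] with ω hω
    by_cases h : ω ∈ A <;> simp [h, hω.le]
  have hmap := map_withDensity_indicator_inv hX hU hA hp hpA hpos hint hCI
  constructor
  · rw [← integrable_congr hae, ← integrable_withDensity_iff_integrable_smul₀' hν.aemeasurable hfin]
    have h1 := integrable_map_measure (μ := P) hF.aestronglyMeasurable hXU.aemeasurable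
    rw [← hmap, integrable_map_measure hF.aestronglyMeasurable hXU.aemeasurable] at h1
    exact h1
  · rw [← integral_congr_ae hae,
      ← integral_withDensity_eq_integral_toReal_smul₀ hν.aemeasurable hfin]
    have h1 := integral_map (μ := P) hXU.aemeasurable (f := F) hF.aestronglyMeasurable
    rw [← hmap, integral_map hXU.aemeasurable hF.aestronglyMeasurable] at h1
    exact h1

end Weighting

/-! ### Treatment arms: overlap, balancing weights, outcome regressions. -/

section Arms

variable {Ω : Type*} [MeasurableSpace Ω] {P : Measure Ω} {d : ℕ} {X : Ω → Covariates d}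
  {W : Ω → Fin 2} {Y : Fin 2 → Ω → ℝ} {e : Covariates d → ℝ} {μ : Fin 2 → Covariates d → ℝ}

/-- The probability of receiving treatment `w`, for the propensity score `e`. -/
def armProb (e : Covariates d → ℝ) (w : Fin 2) (x : Covariates d) : ℝ :=
  if w = 1 then e x else 1 - e x

@[simp] theorem armProb_zero (x : Covariates d) : armProb e 0 x = 1 - e x := rfl

@[simp] theorem armProb_one (x : Covariates d) : armProb e 1 x = e x := rfl

/-- The inverse probability weight `1{W = w} / P(W = w | X)`. -/
noncomputable def armWeight (X : Ω → Covariates d) (W : Ω → Fin 2) (e : Covariates d → ℝ)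
    (w : Fin 2) : Ω → ℝ :=
  (W ⁻¹' {w}).indicator fun ω ↦ (armProb e w (X ω))⁻¹

section

variable {Ω : Type*} {d : ℕ} {X : Ω → Covariates d}
  {W : Ω → Fin 2} {Y : Fin 2 → Ω → ℝ} {e : Covariates d → ℝ}

theorem observedOutcome_of_eq {w : Fin 2} {ω : Ω} (h : W ω = w) :
    observedOutcome W Y ω = Y w ω := by
  subst h
  have : W ω = 0 ∨ W ω = 1 := by omega
  rcases this with h | h <;> simp [observedOutcome, treat, h]

theorem armWeight_of_ne {w : Fin 2} {ω : Ω} (h : W ω ≠ w) : armWeight X W e w ω = 0 := by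
  simp [armWeight, h]

theorem armWeight_of_eq {w : Fin 2} {ω : Ω} (h : W ω = w) :
    armWeight X W e w ω = (armProb e w (X ω))⁻¹ := by
  simp [armWeight, h]

end

theorem measurable_armProb (he : Measurable e) (w : Fin 2) : Measurable (armProb e w) := by
  unfold armProb
  split_ifs
  · exact he
  · exact he.const_sub 1

theorem armProb_ae_eq [IsProbabilityMeasure P] (hX : Measurable X) (hW : Measurable W)
    (he : IsPropensityScore P X W e) (w : Fin 2) :
    ∀ᵐ ω ∂P, armProb e w (X ω) =
      (P⟦W ⁻¹' {w} | MeasurableSpace.comap X inferInstance⟧) ω := by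
  have hm : MeasurableSpace.comap X inferInstance ≤ ‹MeasurableSpace Ω› := hX.comap_le
  fin_cases w
  · have h0 : (W ⁻¹' {0}).indicator (fun _ ↦ (1 : ℝ)) =
        (fun _ ↦ 1) - (W ⁻¹' {1}).indicator (fun _ ↦ (1 : ℝ)) := by
      ext ω
      have : W ω = 0 ∨ W ω = 1 := by omega
      rcases this with h | h <;> simp [h]
    have h1 := condExp_sub (μ := P) (integrable_const (1 : ℝ))
      ((integrable_const (1 : ℝ)).indicator (hW (measurableSet_singleton 1)))
      (MeasurableSpace.comap X inferInstance)
    simp only [Fin.zero_eta, h0]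
    filter_upwards [h1, he.ae_eq] with ω h2 h3
    rw [h2, Pi.sub_apply, ← h3, condExp_const hm, armProb_zero]
  · exact he.ae_eq

theorem GlobalOverlap.armProb_pos (he : Measurable e) (hX : Measurable X)
    (ho : GlobalOverlap P X e) : ∀ᵐ ω ∂P, ∀ w, 0 < armProb e w (X ω) := by
  have hmeas : Measurable fun ω ↦ (ENNReal.ofReal (e (X ω) * (1 - e (X ω))))⁻¹ := by fun_prop
  filter_upwards [ae_lt_top hmeas ho.ne] with ω hω w
  -- Since `0⁻¹ = ∞` and `ofReal` sends negatives to zero, a finite inverse forces a positive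
  -- product, whence `e > e² ≥ 0`.
  have h : 0 < e (X ω) * (1 - e (X ω)) := by simpa using hω
  have h0 : 0 < e (X ω) := by nlinarith [sq_nonneg (e (X ω))]
  have h1 : 0 < 1 - e (X ω) := pos_of_mul_pos_right h h0.le
  fin_cases w
  · exact h1
  · exact h0

theorem GlobalOverlap.integrable_inv_armProb (he : Measurable e) (hX : Measurable X)
    (ho : GlobalOverlap P X e) (w : Fin 2) :
    Integrable (fun ω ↦ (armProb e w (X ω))⁻¹) P := by
  refine ⟨((measurable_armProb he w).comp hX).inv.aestronglyMeasurable, ?_⟩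
  rw [hasFiniteIntegral_iff_norm]
  refine (lintegral_mono_ae ?_).trans_lt ho
  filter_upwards [ho.armProb_pos he hX] with ω hω
  have h0 := hω 0
  have h1 := hω 1
  rw [armProb_zero] at h0
  rw [armProb_one] at h1
  rw [Real.norm_of_nonneg (inv_nonneg.2 (hω w).le), ENNReal.ofReal_inv_of_pos (hω w)]
  -- The product `e (1 - e)` is at most either factor, the other being at most one.
  refine ENNReal.inv_le_inv.2 (ENNReal.ofReal_le_ofReal ?_)
  fin_cases w
  · simp only [Fin.zero_eta, armProb_zero]
    nlinarith
  · simp only [Fin.mk_one, armProb_one]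
    nlinarith

theorem isBalancing_armWeight [IsProbabilityMeasure P] (hX : Measurable X) (hW : Measurable W)
    (hY : ∀ w, Measurable (Y w)) (he : IsPropensityScore P X W e)
    (hunconf : CondIndepGiven P (fun ω ↦ (Y 0 ω, Y 1 ω)) W X) (ho : GlobalOverlap P X e)
    (w : Fin 2) : IsBalancing P X (fun ω ↦ (Y 0 ω, Y 1 ω)) (armWeight X W e w) :=
  isBalancing_indicator_inv hX ((hY 0).prodMk (hY 1)) (hW (measurableSet_singleton w))
    (measurable_armProb he.measurable w) (armProb_ae_eq hX hW he w)
    ((ho.armProb_pos he.measurable hX).mono fun _ h ↦ h w)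
    (ho.integrable_inv_armProb he.measurable hX w)
    fun t ht ↦ hunconf t {w} ht (measurableSet_singleton w)

theorem abs_observedOutcome_le {B : ℝ} (hB : ∀ w, ∀ᵐ ω ∂P, |Y w ω| ≤ B) :
    ∀ᵐ ω ∂P, |observedOutcome W Y ω| ≤ B := by
  filter_upwards [ae_all_iff.2 hB] with ω h
  rw [observedOutcome_of_eq (w := W ω) rfl]
  exact h _

/-- An outcome regression is bounded by any bound on the outcomes. -/
theorem abs_regression_le [IsProbabilityMeasure P] (hX : Measurable X)
    {U : Ω → ℝ × ℝ} {w : Fin 2} {m : Covariates d → ℝ} (hν : IsBalancing P X U (armWeight X W e w))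
    {B : ℝ} (hB : ∀ w, ∀ᵐ ω ∂P, |Y w ω| ≤ B)
    (hm : IsOutcomeRegression P X W (observedOutcome W Y) w m) :
    ∀ᵐ ω ∂P, |m (X ω)| ≤ B := by
  have hobs := abs_observedOutcome_le (W := W) hB
  have hce := ae_bdd_abs_condExp_of_ae_bdd_abs
    (m := MeasurableSpace.comap (fun ω' ↦ (X ω', W ω')) inferInstance) hobs
  have hS : MeasurableSet {x : Covariates d | B < |m x|} :=
    measurableSet_lt measurable_const hm.measurable.abs
  -- The regression is controlled only where `W = w`, which is where the weight lives; balancing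
  -- turns the vanishing weighted mass of the bad set into a vanishing probability.
  have h := (hν (fun z ↦ {x | B < |m x|}.indicator (fun _ ↦ 1) z.1)
    ((measurable_const.indicator hS).comp measurable_fst)).2
  have h0 :
      ∫ ω, armWeight X W e w ω * {x | B < |m x|}.indicator (fun _ ↦ (1 : ℝ)) (X ω) ∂P = 0 := by
    refine integral_eq_zero_of_ae ?_
    filter_upwards [hm.ae_eq, hce] with ω h1 h2
    by_cases hw : W ω = w
    · rw [← h1 hw] at h2
      simp [h2]
    · simp [armWeight_of_ne hw]
  rw [h0] at h
  have h1 : ∫ ω, {x | B < |m x|}.indicator (fun _ ↦ (1 : ℝ)) (X ω) ∂P =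
      P.real (X ⁻¹' {x | B < |m x|}) :=
    integral_indicator_one (hX hS)
  rw [h1, eq_comm, measureReal_eq_zero_iff] at h
  simpa [ae_iff] using h

/-- Under unconfoundedness, the outcome regression for treatment `w` is the conditional expectation
of the potential outcome `Y w`. -/
theorem regression_ae_eq_condExp [IsProbabilityMeasure P] (hX : Measurable X) (hW : Measurable W)
    (hY : ∀ w, Measurable (Y w)) (he : Measurable e) {w : Fin 2} {m : Covariates d → ℝ}
    (hν : IsBalancing P X (fun ω ↦ (Y 0 ω, Y 1 ω)) (armWeight X W e w))
    {B : ℝ} (hB : ∀ w, ∀ᵐ ω ∂P, |Y w ω| ≤ B)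
    (hm : IsOutcomeRegression P X W (observedOutcome W Y) w m) :
    (fun ω ↦ m (X ω)) =ᵐ[P] P[Y w | MeasurableSpace.comap X inferInstance] := by
  have hXm : MeasurableSpace.comap X inferInstance ≤ ‹MeasurableSpace Ω› := hX.comap_le
  have hXW : MeasurableSpace.comap (fun ω' ↦ (X ω', W ω')) inferInstance ≤ ‹MeasurableSpace Ω› :=
    (hX.prodMk hW).comap_le
  have hYi : Integrable (Y w) P := .of_bound (hY w).aestronglyMeasurable B (hB w)
  have hmi : Integrable (fun ω ↦ m (X ω)) P := .of_bound
    (hm.measurable.comp hX).aestronglyMeasurable B (abs_regression_le hX hν hB hm)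
  have hobs := abs_observedOutcome_le (W := W) hB
  have hobsm : Measurable (observedOutcome W Y) := by
    have := hY 0
    have := hY 1
    have : Measurable fun ω ↦ treat (W ω) := (measurable_of_finite treat).comp hW
    unfold observedOutcome
    fun_prop
  have hobsi : Integrable (observedOutcome W Y) P := .of_bound hobsm.aestronglyMeasurable B hobs
  refine ae_eq_condExp_of_forall_setIntegral_eq hXm hYi (fun s _ _ ↦ hmi.integrableOn) ?_
    (hm.measurable.comp (comap_measurable X)).aestronglyMeasurable
  rintro _ ⟨S, hS, rfl⟩ -
  -- This factor is a function of `(X, W)`, so it can be pulled out of the conditional expectation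
  -- that defines the regression, and it vanishes off `W = w`.
  set f : Ω → ℝ := fun ω ↦ armWeight X W e w ω * S.indicator (fun _ ↦ 1) (X ω) with hf
  have hfm : StronglyMeasurable[MeasurableSpace.comap (fun ω' ↦ (X ω', W ω')) inferInstance] f := by
    have h : Measurable fun z : Covariates d × Fin 2 ↦
        ({w} : Set (Fin 2)).indicator (fun _ ↦ (armProb e w z.1)⁻¹) z.2 *
          S.indicator (fun _ ↦ (1 : ℝ)) z.1 := by
      refine Measurable.mul ?_ ((measurable_const.indicator hS).comp measurable_fst)
      exact ((measurable_armProb he w).comp measurable_fst).inv.indicator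
        (measurable_snd (measurableSet_singleton w))
    exact (h.comp (comap_measurable _)).stronglyMeasurable
  have hfi : Integrable f P := ((hν (fun z ↦ S.indicator (fun _ ↦ 1) z.1)
    ((measurable_const.indicator hS).comp measurable_fst)).1.2
      ((integrable_const (1 : ℝ)).indicator (hX hS)))
  have hind (g : Ω → ℝ) (ω : Ω) :
      (X ⁻¹' S).indicator g ω = S.indicator (fun _ ↦ (1 : ℝ)) (X ω) * g ω := by
    by_cases h : X ω ∈ S <;> simp [h]
  rw [← integral_indicator (hX hS), ← integral_indicator (hX hS)]
  simp only [hind]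
  have hYw : Measurable fun z : ℝ × ℝ ↦ if w = 0 then z.1 else z.2 := by
    split_ifs <;> fun_prop
  have hYw' (ω : Ω) : (if w = 0 then Y 0 ω else Y 1 ω) = Y w ω := by
    fin_cases w <;> rfl
  have hindm : Measurable fun z : Covariates d × ℝ × ℝ ↦ S.indicator (fun _ ↦ (1 : ℝ)) z.1 :=
    (measurable_const.indicator hS).comp measurable_fst
  have h1 := (hν (fun z ↦ S.indicator (fun _ ↦ 1) z.1 * m z.1)
    (hindm.mul (hm.measurable.comp measurable_fst))).2
  have h2 := (hν (fun z ↦ S.indicator (fun _ ↦ 1) z.1 * if w = 0 then z.2.1 else z.2.2)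
    (hindm.mul (hYw.comp measurable_snd))).2
  simp only [hYw'] at h2
  have hfo : Integrable (f * observedOutcome W Y) P :=
    hfi.mul_bdd hobsm.aestronglyMeasurable hobs
  rw [← h1, ← h2]
  calc ∫ ω, armWeight X W e w ω * (S.indicator (fun _ ↦ 1) (X ω) * m (X ω)) ∂P
      = ∫ ω, (P[f * observedOutcome W Y |
          MeasurableSpace.comap (fun ω' ↦ (X ω', W ω')) inferInstance]) ω ∂P := by
        refine integral_congr_ae ?_
        filter_upwards [hm.ae_eq, condExp_mul_of_stronglyMeasurable_left hfm hfo hobsi]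
          with ω h3 h4
        rw [h4, Pi.mul_apply]
        by_cases hw : W ω = w
        · rw [← h3 hw]
          simp only [hf]
          ring
        · simp [hf, armWeight_of_ne hw]
    _ = ∫ ω, (f * observedOutcome W Y) ω ∂P := integral_condExp hXW
    _ = ∫ ω, armWeight X W e w ω * (S.indicator (fun _ ↦ 1) (X ω) * Y w ω) ∂P := by
        refine integral_congr_ae (.of_forall fun ω ↦ ?_)
        by_cases hw : W ω = w
        · simp only [hf, Pi.mul_apply, observedOutcome_of_eq hw]
          ring
        · simp [hf, armWeight_of_ne hw]

end Arms

/-! ### Moments and central limit theorem for sample means. -/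

section SampleMean

variable {Ω Ω' β : Type*} [MeasurableSpace Ω] [MeasurableSpace Ω'] [MeasurableSpace β]
  {P : Measure Ω} {Q : Measure Ω'} [IsProbabilityMeasure Q]
  {O : ℕ → Ω' → β} {T : Ω → β} {g : β → ℝ}

theorem sampleMean_moments (hindep : iIndepFun O Q) (hident : ∀ i, IdentDistrib (O i) T Q P)
    (hg : Measurable g) (hL2 : MemLp (fun ω ↦ g (T ω)) 2 P) {n : ℕ} (hn : 1 ≤ n) :
    MemLp (fun ω ↦ (1 / (n : ℝ)) * ∑ i ∈ Finset.range n, g (O i ω)) 2 Q ∧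
    ∫ ω, (1 / (n : ℝ)) * ∑ i ∈ Finset.range n, g (O i ω) ∂Q = ∫ ω, g (T ω) ∂P ∧
    Var[fun ω ↦ (1 / (n : ℝ)) * ∑ i ∈ Finset.range n, g (O i ω); Q] =
      Var[fun ω ↦ g (T ω); P] / n := by
  have hid (i : ℕ) : IdentDistrib (fun ω ↦ g (O i ω)) (fun ω ↦ g (T ω)) Q P := (hident i).comp hg
  have hmem (i : ℕ) : MemLp (fun ω ↦ g (O i ω)) 2 Q := (hid i).memLp_iff.2 hL2
  have hn0 : (n : ℝ) ≠ 0 := by positivity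
  refine ⟨(memLp_finsetSum _ fun i _ ↦ hmem i).const_mul _, ?_, ?_⟩
  · rw [integral_const_mul, integral_finsetSum _ fun i _ ↦ (hmem i).integrable one_le_two]
    simp only [(hid _).integral_eq, Finset.sum_const, Finset.card_range, nsmul_eq_mul]
    field_simp
  · have hsum : (fun ω ↦ ∑ i ∈ Finset.range n, g (O i ω)) =
        ∑ i ∈ Finset.range n, fun ω ↦ g (O i ω) := by
      ext ω
      simp
    rw [variance_const_mul, hsum, IndepFun.variance_sum (fun i _ ↦ hmem i)
      fun i _ j _ hij ↦ (hindep.indepFun hij).comp hg hg]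
    simp only [(hid _).variance_eq, Finset.sum_const, Finset.card_range, nsmul_eq_mul]
    field_simp

theorem tendstoInDistribution_sampleMean (hindep : iIndepFun O Q)
    (hident : ∀ i, IdentDistrib (O i) T Q P) (hg : Measurable g)
    (hL2 : MemLp (fun ω ↦ g (T ω)) 2 P) :
    TendstoInDistribution
      (fun (n : ℕ) (ω : Ω') ↦ √(n : ℝ) *
        ((1 / (n : ℝ)) * ∑ i ∈ Finset.range n, g (O i ω) - ∫ ω, g (T ω) ∂P)) atTop
      (id : ℝ → ℝ) (fun _ ↦ Q) (gaussianReal 0 (Var[fun ω ↦ g (T ω); P]).toNNReal) := by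
  have hid (i : ℕ) : IdentDistrib (fun ω ↦ g (O i ω)) (fun ω ↦ g (T ω)) Q P := (hident i).comp hg
  have h := tendstoInDistribution_inv_sqrt_mul_sum_sub (X := fun i ω ↦ g (O i ω)) (P := Q)
    (Y := (id : ℝ → ℝ)) (P' := gaussianReal 0 (Var[fun ω ↦ g (T ω); P]).toNNReal)
    (by rw [(hid 0).variance_eq]; exact HasLaw.id) ((hid 0).memLp_iff.2 hL2)
    (hindep.comp (fun _ ↦ g) fun _ ↦ hg) fun i ↦ (hid i).trans (hid 0).symm
  convert h using 3 with n ω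
  rw [(hid 0).integral_eq]
  -- At `n = 0` both normalizations give zero.
  rcases eq_or_ne n 0 with rfl | hn
  · simp
  · have hn' : 0 < (n : ℝ) := by positivity
    have := Real.mul_self_sqrt hn'.le
    field_simp
    rw [Real.sq_sqrt hn'.le]

end SampleMean

/-! ### Moments of the IPW and AIPW scores. -/

section Scores

theorem aipwScore_observedTuple {Ω : Type*} {d K : ℕ} {X : Ω → Covariates d} {H : Ω → Fin K}
    {W : Ω → Fin 2} {Y : Fin 2 → Ω → ℝ} {e : Covariates d → ℝ} {μ : Fin 2 → Covariates d → ℝ}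
    (ω : Ω) :
    aipwScore e μ (observedTuple X H W Y ω) =
    (μ 1 (X ω) - μ 0 (X ω)) + armWeight X W e 1 ω * (Y 1 ω - μ 1 (X ω)) -
      armWeight X W e 0 ω * (Y 0 ω - μ 0 (X ω)) := by
  have : W ω = 0 ∨ W ω = 1 := by omega
  rcases this with hw | hw
  · simp [aipwScore, observedTuple, observedOutcome_of_eq hw, hw, treat, armWeight]
    ring
  · simp [aipwScore, observedTuple, observedOutcome_of_eq hw, hw, treat, armWeight]
    ring

/-- Integrability and second moment of an inverse probability weighted residual. -/
theorem armWeight_mul_moments {Ω : Type*} [MeasurableSpace Ω] {P : Measure Ω} {d : ℕ}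
    {X : Ω → Covariates d} {W : Ω → Fin 2} {e : Covariates d → ℝ} (hX : Measurable X)
    (hW : Measurable W) (he : Measurable e) (ho : GlobalOverlap P X e) {U : Ω → ℝ × ℝ}
    (hU : Measurable U) {w : Fin 2}
    (hν : IsBalancing P X U (armWeight X W e w))
    {F : Covariates d × ℝ × ℝ → ℝ} (hF : Measurable F) {C : ℝ}
    (hC : ∀ᵐ ω ∂P, |F (X ω, U ω)| ≤ C) :
    Integrable (fun ω ↦ F (X ω, U ω) ^ 2 / armProb e w (X ω)) P ∧
    MemLp (fun ω ↦ armWeight X W e w ω * F (X ω, U ω)) 2 P ∧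
    ∫ ω, (armWeight X W e w ω * F (X ω, U ω)) ^ 2 ∂P =
      ∫ ω, F (X ω, U ω) ^ 2 / armProb e w (X ω) ∂P := by
  have hFm : Measurable fun ω ↦ F (X ω, U ω) := hF.comp (hX.prodMk hU)
  have hp := measurable_armProb he w
  have h1 : Integrable (fun ω ↦ F (X ω, U ω) ^ 2 / armProb e w (X ω)) P := by
    refine (ho.integrable_inv_armProb he hX w).bdd_mul (c := C ^ 2)
      (hFm.pow_const 2).aestronglyMeasurable ?_
    filter_upwards [hC] with ω hω
    rw [Real.norm_eq_abs, abs_pow]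
    gcongr
  -- Balancing is applied to `F² / p` rather than `F²`: one more weight turns it into the square of
  -- the weighted `F`.
  have h2 := hν (fun z ↦ F z ^ 2 / armProb e w z.1)
    ((hF.pow_const 2).div (hp.comp measurable_fst))
  have h3 (ω : Ω) : armWeight X W e w ω * (F (X ω, U ω) ^ 2 / armProb e w (X ω)) =
      (armWeight X W e w ω * F (X ω, U ω)) ^ 2 := by
    by_cases hw : W ω = w
    · rw [armWeight_of_eq hw]
      ring
    · simp [armWeight_of_ne hw]
  simp only [h3] at h2
  have hνm : Measurable (armWeight X W e w) :=
    (hp.comp hX).inv.indicator (hW (measurableSet_singleton w))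
  exact ⟨h1, (memLp_two_iff_integrable_sq (hνm.mul hFm).aestronglyMeasurable).2 (h2.1.2 h1), h2.2⟩

variable {Ω : Type*} [MeasurableSpace Ω] {P : Measure Ω} [IsProbabilityMeasure P] {d K : ℕ}
  {X : Ω → Covariates d} {H : Ω → Fin K} {W : Ω → Fin 2} {Y : Fin 2 → Ω → ℝ}
  {e : Covariates d → ℝ} {μ : Fin 2 → Covariates d → ℝ}

/-- First and second moments of a score consisting of a function of the covariates and inverse
probability weighted residuals orthogonal to it. -/
theorem augmentedScore_moments (hX : Measurable X) (hW : Measurable W)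
    (hY : ∀ w, Measurable (Y w)) (he : Measurable e) (ho : GlobalOverlap P X e)
    (hν : ∀ w, IsBalancing P X (fun ω ↦ (Y 0 ω, Y 1 ω)) (armWeight X W e w))
    {m : Fin 2 → Covariates d → ℝ} (hm : ∀ w, Measurable (m w))
    {C : ℝ} (hC : ∀ w, ∀ᵐ ω ∂P, |Y w ω - m w (X ω)| ≤ C)
    {D : Covariates d → ℝ} (hD : Measurable D) {C' : ℝ} (hC' : ∀ᵐ ω ∂P, |D (X ω)| ≤ C')
    (horth : ∀ w, ∫ ω, D (X ω) * (Y w ω - m w (X ω)) ∂P = 0) :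
    (∀ w, Integrable (fun ω ↦ (Y w ω - m w (X ω)) ^ 2 / armProb e w (X ω)) P) ∧
    MemLp (fun ω ↦ D (X ω) + armWeight X W e 1 ω * (Y 1 ω - m 1 (X ω)) -
      armWeight X W e 0 ω * (Y 0 ω - m 0 (X ω))) 2 P ∧
    ∫ ω, (D (X ω) + armWeight X W e 1 ω * (Y 1 ω - m 1 (X ω)) -
      armWeight X W e 0 ω * (Y 0 ω - m 0 (X ω))) ∂P =
      ∫ ω, D (X ω) ∂P + ∫ ω, (Y 1 ω - m 1 (X ω)) ∂P - ∫ ω, (Y 0 ω - m 0 (X ω)) ∂P ∧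
    ∫ ω, (D (X ω) + armWeight X W e 1 ω * (Y 1 ω - m 1 (X ω)) -
      armWeight X W e 0 ω * (Y 0 ω - m 0 (X ω))) ^ 2 ∂P =
      ∫ ω, D (X ω) ^ 2 ∂P + ∫ ω, (Y 1 ω - m 1 (X ω)) ^ 2 / e (X ω) ∂P +
        ∫ ω, (Y 0 ω - m 0 (X ω)) ^ 2 / (1 - e (X ω)) ∂P := by
  have hYw (ω : Ω) (w : Fin 2) : (if w = 0 then Y 0 ω else Y 1 ω) = Y w ω := by
    fin_cases w <;> rfl
  have hF (w : Fin 2) : Measurable fun z : Covariates d × ℝ × ℝ ↦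
      (if w = 0 then z.2.1 else z.2.2) - m w z.1 := by
    have := hm w
    split_ifs <;> fun_prop
  have hmom (w : Fin 2) := armWeight_mul_moments hX hW he ho ((hY 0).prodMk (hY 1)) (hν w) (hF w)
    (by simpa only [hYw] using hC w)
  have hmean (w : Fin 2) := (hν w _ (hF w)).2
  have hcross (w : Fin 2) := (hν w _ ((hD.comp measurable_fst).mul (hF w))).2
  simp only [hYw, Function.comp_apply, Pi.mul_apply] at hmom hmean hcross
  have hDL : MemLp (fun ω ↦ D (X ω)) 2 P := .of_bound (hD.comp hX).aestronglyMeasurable C' hC'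
  have hL (w : Fin 2) := (hmom w).2.1
  refine ⟨fun w ↦ (hmom w).1, (hDL.add (hL 1)).sub (hL 0), ?_, ?_⟩
  · have hDL1 : Integrable
        (fun ω ↦ D (X ω) + armWeight X W e 1 ω * (Y 1 ω - m 1 (X ω))) P :=
      (hDL.add (hL 1)).integrable one_le_two
    rw [integral_sub hDL1 ((hL 0).integrable one_le_two),
      integral_add (hDL.integrable one_le_two) ((hL 1).integrable one_le_two), hmean, hmean]
  · have hc (w : Fin 2) : ∫ ω, D (X ω) * (armWeight X W e w ω * (Y w ω - m w (X ω))) ∂P = 0 := by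
      rw [← horth w, ← hcross w]
      exact integral_congr_ae (.of_forall fun ω ↦ mul_left_comm _ _ _)
    have hci (w : Fin 2) :
        Integrable (fun ω ↦ D (X ω) * (armWeight X W e w ω * (Y w ω - m w (X ω)))) P :=
      hDL.integrable_mul (hL w)
    have hexp (ω : Ω) : (D (X ω) + armWeight X W e 1 ω * (Y 1 ω - m 1 (X ω)) -
        armWeight X W e 0 ω * (Y 0 ω - m 0 (X ω))) ^ 2 =
        D (X ω) ^ 2 + (armWeight X W e 1 ω * (Y 1 ω - m 1 (X ω))) ^ 2 +
        (armWeight X W e 0 ω * (Y 0 ω - m 0 (X ω))) ^ 2 +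
        2 * (D (X ω) * (armWeight X W e 1 ω * (Y 1 ω - m 1 (X ω)))) -
        2 * (D (X ω) * (armWeight X W e 0 ω * (Y 0 ω - m 0 (X ω)))) := by
      -- Nobody receives both treatments, so the cross term between arms vanishes pointwise.
      have h0 : armWeight X W e 1 ω * armWeight X W e 0 ω = 0 := by
        by_cases hw : W ω = 1
        · rw [armWeight_of_ne (w := 0) (by simp [hw]), mul_zero]
        · rw [armWeight_of_ne hw, zero_mul]
      linear_combination (-2 * (Y 1 ω - m 1 (X ω)) * (Y 0 ω - m 0 (X ω))) * h0
    simp only [hexp]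
    have i0 := hDL.integrable_sq
    have i1 := (hL 1).integrable_sq
    have i2 := (hL 0).integrable_sq
    have i3 := (hci 1).const_mul 2
    have i4 := (hci 0).const_mul 2
    rw [integral_sub (((i0.fun_add i1).fun_add i2).fun_add i3) i4,
      integral_add ((i0.fun_add i1).fun_add i2) i3, integral_add (i0.fun_add i1) i2,
      integral_add i0 i1, integral_const_mul, integral_const_mul, hc,
      hc, (hmom 1).2.2, (hmom 0).2.2]
    simp

theorem measurable_aipwScore (he : Measurable e) (hμ : ∀ w, Measurable (μ w)) :
    Measurable (aipwScore (K := K) e μ) := by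
  have h : aipwScore (K := K) e μ = fun o : Observation d K ↦
      μ 1 o.2.1 - μ 0 o.2.1 + treat o.2.2.1 * (o.2.2.2 - μ 1 o.2.1) / e o.2.1
        - (1 - treat o.2.2.1) * (o.2.2.2 - μ 0 o.2.1) / (1 - e o.2.1) := rfl
  have h0 := hμ 0
  have h1 := hμ 1
  have ht : Measurable treat := measurable_of_finite _
  rw [h]
  fun_prop

theorem ipwScore_eq_aipwScore : ipwScore (K := K) e = aipwScore e 0 := by
  ext ⟨h, x, w, y⟩
  simp [ipwScore, aipwScore]

/-- Orthogonality of a conditional expectation's residual to bounded functions of `X`; it supplies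
the orthogonality required of the AIPW score. -/
theorem integral_mul_sub_eq_zero (hX : Measurable X) {D m : Covariates d → ℝ} (hD : Measurable D)
    {V : Ω → ℝ} (hV : Integrable V P) {C : ℝ} (hC : ∀ᵐ ω ∂P, |D (X ω)| ≤ C)
    (hm : (fun ω ↦ m (X ω)) =ᵐ[P] P[V | MeasurableSpace.comap X inferInstance]) :
    ∫ ω, D (X ω) * (V ω - m (X ω)) ∂P = 0 := by
  have hDm : StronglyMeasurable[MeasurableSpace.comap X inferInstance] fun ω ↦ D (X ω) :=
    (hD.comp (comap_measurable X)).stronglyMeasurable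
  have hDa : AEStronglyMeasurable (fun ω ↦ D (X ω)) P := (hD.comp hX).aestronglyMeasurable
  have hi : Integrable (fun ω ↦ D (X ω) * V ω) P := hV.bdd_mul hDa hC
  have hmi : Integrable (fun ω ↦ m (X ω)) P := integrable_condExp.congr hm.symm
  simp only [mul_sub]
  rw [integral_sub hi (hmi.bdd_mul hDa hC), sub_eq_zero, ← integral_condExp hX.comap_le]
  refine integral_congr_ae ?_
  filter_upwards [hm, condExp_mul_of_stronglyMeasurable_left hDm hi hV] with ω h1 h2
  rw [h1]
  exact h2

/-- The moments of the IPW score. -/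
theorem ipwScore_moments (hX : Measurable X) (hW : Measurable W)
    (hY : ∀ w, Measurable (Y w)) {B : ℝ} (hB : ∀ w, ∀ᵐ ω ∂P, |Y w ω| ≤ B)
    (he : Measurable e) (ho : GlobalOverlap P X e)
    (hν : ∀ w, IsBalancing P X (fun ω ↦ (Y 0 ω, Y 1 ω)) (armWeight X W e w)) :
    (∀ w, Integrable (fun ω ↦ Y w ω ^ 2 / armProb e w (X ω)) P) ∧
    MemLp (fun ω ↦ ipwScore e (observedTuple X H W Y ω)) 2 P ∧
    ∫ ω, ipwScore e (observedTuple X H W Y ω) ∂P = ate P Y ∧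
    Var[fun ω ↦ ipwScore e (observedTuple X H W Y ω); P] = ipwVariance P X Y e := by
  have hYi (w : Fin 2) : Integrable (Y w) P := .of_bound (hY w).aestronglyMeasurable B (hB w)
  have h := augmentedScore_moments (m := 0) (D := 0) (C := B) (C' := 0) hX hW hY he ho hν
    (fun _ ↦ measurable_const) (by simpa using hB) measurable_const (by simp) (by simp)
  have hS : (fun ω ↦ ipwScore e (observedTuple X H W Y ω)) = fun ω ↦
      armWeight X W e 1 ω * Y 1 ω - armWeight X W e 0 ω * Y 0 ω := by
    ext ω
    rw [ipwScore_eq_aipwScore, aipwScore_observedTuple]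
    simp
  simp only [Pi.zero_apply, sub_zero, zero_add, integral_zero] at h
  obtain ⟨h1, h2, h3, h4⟩ := h
  have h5 : ∫ ω, (armWeight X W e 1 ω * Y 1 ω - armWeight X W e 0 ω * Y 0 ω) ∂P = ate P Y := by
    rw [h3, ate, integral_sub (hYi 1) (hYi 0)]
  refine ⟨h1, ?_, ?_, ?_⟩
  · rwa [hS]
  · rw [hS, h5]
  · rw [hS, variance_eq_sub h2, h5, ipwVariance]
    simp only [Pi.pow_apply]
    rw [h4]
    simp

/-- The moments of the AIPW score. -/
theorem aipwScore_moments (hX : Measurable X) (hW : Measurable W)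
    (hY : ∀ w, Measurable (Y w)) {B : ℝ} (hB : ∀ w, ∀ᵐ ω ∂P, |Y w ω| ≤ B)
    (he : Measurable e) (ho : GlobalOverlap P X e)
    (hν : ∀ w, IsBalancing P X (fun ω ↦ (Y 0 ω, Y 1 ω)) (armWeight X W e w))
    (hμ : ∀ w, IsOutcomeRegression P X W (observedOutcome W Y) w (μ w)) :
    (∀ w, Integrable (fun ω ↦ (Y w ω - μ w (X ω)) ^ 2 / armProb e w (X ω)) P) ∧
    MemLp (fun ω ↦ aipwScore e μ (observedTuple X H W Y ω)) 2 P ∧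
    ∫ ω, aipwScore e μ (observedTuple X H W Y ω) ∂P = ate P Y ∧
    Var[fun ω ↦ aipwScore e μ (observedTuple X H W Y ω); P] = aipwVariance P X Y e μ := by
  have hYi (w : Fin 2) : Integrable (Y w) P := .of_bound (hY w).aestronglyMeasurable B (hB w)
  have hμB (w : Fin 2) := abs_regression_le hX (hν w) hB (hμ w)
  have hμY (w : Fin 2) := regression_ae_eq_condExp hX hW hY he (hν w) hB (hμ w)
  have hμm (w : Fin 2) := (hμ w).measurable
  have hμi (w : Fin 2) : Integrable (fun ω ↦ μ w (X ω)) P := integrable_condExp.congr (hμY w).symm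
  have hμint (w : Fin 2) : ∫ ω, μ w (X ω) ∂P = ∫ ω, Y w ω ∂P := by
    rw [integral_congr_ae (hμY w), integral_condExp hX.comap_le]
  have hate : ate P Y = ∫ ω, Y 1 ω ∂P - ∫ ω, Y 0 ω ∂P := integral_sub (hYi 1) (hYi 0)
  -- Subtracting `τ` centres the score, so its second moment is its variance and that of `D(X)` is
  -- `Var[τ(X)]`.
  set D : Covariates d → ℝ := fun x ↦ μ 1 x - μ 0 x - ate P Y with hDdef
  have hD : Measurable D := ((hμm 1).sub (hμm 0)).sub_const _
  have hDB : ∀ᵐ ω ∂P, |D (X ω)| ≤ B + B + |ate P Y| := by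
    filter_upwards [hμB 0, hμB 1] with ω h0 h1
    exact (abs_sub _ _).trans (add_le_add_left ((abs_sub _ _).trans (add_le_add h1 h0)) _)
  have hres (w : Fin 2) : ∀ᵐ ω ∂P, |Y w ω - μ w (X ω)| ≤ B + B := by
    filter_upwards [hμB w, hB w] with ω h0 h1
    exact (abs_sub _ _).trans (add_le_add h1 h0)
  obtain ⟨h1, h2, h3, h4⟩ := augmentedScore_moments hX hW hY he ho hν hμm hres hD hDB
    fun w ↦ integral_mul_sub_eq_zero hX hD (hYi w) hDB (hμY w)
  have hDint : ∫ ω, D (X ω) ∂P = 0 := by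
    simp only [hDdef]
    rw [integral_sub ((hμi 1).sub' (hμi 0)) (integrable_const _), integral_sub (hμi 1) (hμi 0),
      hμint, hμint, hate]
    simp
  have hDvar : ∫ ω, D (X ω) ^ 2 ∂P = Var[cate P X Y; P] := by
    have hc : cate P X Y =ᵐ[P] fun ω ↦ μ 1 (X ω) - μ 0 (X ω) := by
      filter_upwards [condExp_sub (hYi 1) (hYi 0) (MeasurableSpace.comap X inferInstance),
        hμY 0, hμY 1] with ω h5 h6 h7
      rw [h6, h7]
      exact h5
    rw [variance_congr hc, variance_eq_integral ((hμi 1).sub' (hμi 0)).aemeasurable,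
      integral_sub (hμi 1) (hμi 0), hμint, hμint, ← hate]
  have hres0 (w : Fin 2) : ∫ ω, (Y w ω - μ w (X ω)) ∂P = 0 := by
    rw [integral_sub (hYi w) (hμi w), hμint, sub_self]
  rw [hDint, hres0, hres0, add_zero, sub_zero] at h3
  set S : Ω → ℝ := fun ω ↦ D (X ω) + armWeight X W e 1 ω * (Y 1 ω - μ 1 (X ω)) -
      armWeight X W e 0 ω * (Y 0 ω - μ 0 (X ω)) with hSdef
  have hS : (fun ω ↦ aipwScore e μ (observedTuple X H W Y ω)) = fun ω ↦ S ω + ate P Y := by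
    ext ω
    rw [aipwScore_observedTuple]
    simp only [hSdef, hDdef]
    ring
  refine ⟨h1, ?_, ?_, ?_⟩
  · rw [hS]
    exact h2.add (memLp_const _)
  · rw [hS, integral_add (h2.integrable one_le_two) (integrable_const _), h3]
    simp
  · rw [hS, variance_add_const h2.1, variance_of_integral_eq_zero h2.1.aemeasurable h3, h4, hDvar,
      aipwVariance]

end Scores
end FedCausal

/-! ### Transfer from the scores to the estimators. -/

theorem theorem2p1 {d K : ℕ}
    -- the population `(X, H, W, Y(0), Y(1))`
    {Ω : Type*} [MeasurableSpace Ω] (P : Measure Ω) [IsProbabilityMeasure P]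
    (X : Ω → Covariates d) (H : Ω → Fin K) (W : Ω → Fin 2) (Y : Fin 2 → Ω → ℝ)
    (hX : Measurable X) (hH : Measurable H) (hW : Measurable W) (hY : ∀ w, Measurable (Y w))
    (hbdd : ∃ B : ℝ, ∀ w, ∀ᵐ ω ∂P, |Y w ω| ≤ B)
    -- the oracle nuisance functions
    (e : Covariates d → ℝ) (μ : Fin 2 → Covariates d → ℝ)
    (he : IsPropensityScore P X W e)
    (hμ : ∀ w, IsOutcomeRegression P X W (observedOutcome W Y) w (μ w))
    -- unconfoundedness, ignorability on sites, global overlap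
    (hunconf : CondIndepGiven P (fun ω ↦ (Y 0 ω, Y 1 ω)) W X)
    (hsites : CondIndepGiven P (fun ω ↦ (Y 0 ω, Y 1 ω)) H X)
    (hoverlap : GlobalOverlap P X e)
    -- the i.i.d. observations
    {Ω' : Type*} [MeasurableSpace Ω'] (Q : Measure Ω') [IsProbabilityMeasure Q]
    (O : ℕ → Ω' → Observation d K) (hindep : iIndepFun O Q)
    (hident : ∀ i, IdentDistrib (O i) (observedTuple X H W Y) Q P) :
    -- IPW
    (Integrable (fun ω ↦ Y 1 ω ^ 2 / e (X ω)) P ∧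
      Integrable (fun ω ↦ Y 0 ω ^ 2 / (1 - e (X ω))) P ∧
      (∀ n : ℕ, 1 ≤ n →
        MemLp (ipwEstimator e O n) 2 Q ∧
        ∫ ω, ipwEstimator e O n ω ∂Q = ate P Y ∧
        Var[ipwEstimator e O n; Q] = ipwVariance P X Y e / n) ∧
      TendstoInDistribution
        (fun (n : ℕ) (ω : Ω') ↦ √(n : ℝ) * (ipwEstimator e O n ω - ate P Y)) atTop
        (id : ℝ → ℝ) (fun _ ↦ Q) (gaussianReal 0 (ipwVariance P X Y e).toNNReal)) ∧
    -- AIPW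
    (MemLp (cate P X Y) 2 P ∧
      Integrable (fun ω ↦ (Y 1 ω - μ 1 (X ω)) ^ 2 / e (X ω)) P ∧
      Integrable (fun ω ↦ (Y 0 ω - μ 0 (X ω)) ^ 2 / (1 - e (X ω))) P ∧
      (∀ n : ℕ, 1 ≤ n →
        MemLp (aipwEstimator e μ O n) 2 Q ∧
        ∫ ω, aipwEstimator e μ O n ω ∂Q = ate P Y ∧
        Var[aipwEstimator e μ O n; Q] = aipwVariance P X Y e μ / n) ∧
      TendstoInDistribution
        (fun (n : ℕ) (ω : Ω') ↦ √(n : ℝ) * (aipwEstimator e μ O n ω - ate P Y)) atTop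
        (id : ℝ → ℝ) (fun _ ↦ Q) (gaussianReal 0 (aipwVariance P X Y e μ).toNNReal)) := by
  obtain ⟨B, hB⟩ := hbdd
  have hν := isBalancing_armWeight hX hW hY he hunconf hoverlap
  have hem := he.measurable
  have hYi (w : Fin 2) : MemLp (Y w) 2 P := .of_bound (hY w).aestronglyMeasurable B (hB w)
  obtain ⟨a1, a2, a3, a4⟩ := ipwScore_moments (H := H) hX hW hY hB hem hoverlap hν
  obtain ⟨b1, b2, b3, b4⟩ := aipwScore_moments (H := H) hX hW hY hB hem hoverlap hν hμ
  have hipw : Measurable (ipwScore (K := K) e) :=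
    ipwScore_eq_aipwScore ▸ measurable_aipwScore hem fun _ ↦ measurable_const
  have haipw := measurable_aipwScore (K := K) hem fun w ↦ (hμ w).measurable
  refine ⟨⟨a1 1, a1 0, fun n hn ↦ ?_, ?_⟩, ((hYi 1).sub (hYi 0)).condExp one_le_two, b1 1, b1 0,
    fun n hn ↦ ?_, ?_⟩
  · rw [← a3, ← a4]
    exact sampleMean_moments hindep hident hipw a2 hn
  · rw [← a3, ← a4]
    exact tendstoInDistribution_sampleMean hindep hident hipw a2
  · rw [← b3, ← b4]
    exact sampleMean_moments hindep hident haipw b2 hn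
  · rw [← b3, ← b4]
    exact tendstoInDistribution_sampleMean hindep hident haipw b2
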